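/- Let $n\ge 1$ and let $M$ be a smooth manifold of dimension $2n+1$ with a contact form $\eta$, i.e. a smooth $1$-form such that $\eta\wedge(d\eta)^{n}$ is a volume form. Let $\flat_\eta:TM\to T^*M$, $\flat_\eta(X)=-i_Xd\eta+\eta(X)\eta$, which is an isomorphism, and let $\sharp_\eta=\flat_\eta^{-1}$. Let $(\pi,\xi)$ be the Jacobi structure associated with $\eta$, i.e. the bivector field $\pi(\alpha,\beta)=d\eta(\sharp_\eta(\alpha),\sharp_\eta(\beta))$ and the vector field $\xi=\sharp_\eta(\eta)$. Define $\sharp_\pi:T^*M\to TM$ by $\beta(\sharp_\pi(\alpha))=\pi(\alpha,\beta)$, put $\sharp_{\pi,\xi}(\alpha)=\sharp_\pi(\alpha)+\alpha(\xi)\xi$, and for $1$-forms $\alpha,\beta$ put $$[\alpha,\beta]_\pi=\mathcal L_{\sharp_\pi(\alpha)}\beta-\mathcal L_{\sharp_\pi(\beta)}\alpha-d(\pi(\alpha,\beta)),$$ $$[\alpha,\beta]^{\eta}_{\pi,\xi}=[\alpha,\beta]_\pi+\alpha(\xi)(\mathcal L_\xi\beta-\beta)-\beta(\xi)(\mathcal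 L_\xi\alpha-\alpha)-\pi(\alpha,\beta)\,\eta .$$ Then $\sharp_{\pi,\xi}=\sharp_\eta$, and $(T^*M,\sharp_{\pi,\xi},[\cdot,\cdot]^{\eta}_{\pi,\xi})$ is a Lie algebroid: $\sharp_{\pi,\xi}$ is a vector bundle morphism, the bracket is an alternating $\mathbb R$-bilinear map $\Omega^1(M)\times\Omega^1(M)\to\Omega^1(M)$ with $[\alpha,\varphi\beta]=\varphi[\alpha,\beta]+\sharp_{\pi,\xi}(\alpha)(\varphi)\,\beta$ for all $\varphi\in C^\infty(M)$, and it satisfies the Jacobi identity. Moreover this Lie algebroid is isomorphic to the tangent algebroid $(TM,\mathrm{id},[\cdot,\cdot])$: there is a vector bundle isomorphism $\Phi:T^*M\to TM$ over $\mathrm{id}_M$ that commutes with the anchors (so $\Phi=\sharp_{\pi,\xi}$) and satisfies $\Phi([\alpha,\beta]^{\eta}_{\pi,\xi})=[\Phi(\alpha),\Phi(\beta)]$ for all $\alpha,\beta\in\Omega^1(M)$. -/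

import Mathlib

open Bundle Set Filter
open scoped Manifold ContDiff Topology Bundle

noncomputable section

namespace ContactAlgebroid

/-! ### Wedge products of alternating forms on a vector space -/

section Wedge

variable {V : Type*} [AddCommGroup V] [Module ℝ V]

/-- The wedge product `a ∧ b`, with the normalisation
`(a ∧ b)(v) = ∑ sign(σ) a(v_σ(1), …, v_σ(m)) b(v_σ(m+1), …, v_σ(m+k))`, the sum being over the
`(m, k)`-shuffles `σ`. -/
def wedge {m k : ℕ} (a : V [⋀^Fin m]→ₗ[ℝ] ℝ) (b : V [⋀^Fin k]→ₗ[ℝ] ℝ) :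
    V [⋀^Fin (m + k)]→ₗ[ℝ] ℝ :=
  ((LinearMap.mul' ℝ ℝ).compAlternatingMap (a.domCoprod b)).domDomCongr finSumFinEquiv

/-- The `n`-th wedge power `w ∧ ⋯ ∧ w` of a `2`-form; it is a `2n`-form. -/
def wedgePow (w : V [⋀^Fin 2]→ₗ[ℝ] ℝ) : (n : ℕ) → V [⋀^Fin (2 * n)]→ₗ[ℝ] ℝ
  | 0 => (AlternatingMap.constOfIsEmpty ℝ V (Fin 0) (1 : ℝ) : V [⋀^Fin 0]→ₗ[ℝ] ℝ)
  | n + 1 => wedge (wedgePow w n) w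

end Wedge

variable {E : Type*} [NormedAddCommGroup E] [NormedSpace ℝ E]
  {M : Type*} [TopologicalSpace M] [ChartedSpace E M]

/-! ### Tangent and cotangent spaces -/

variable (E) in
/-- The tangent space `T_x M`. -/
abbrev Tan (x : M) : Type _ := TangentSpace 𝓘(ℝ, E) x

variable (E) in
/-- The cotangent space `T*_x M`, the fibre at `x` of the cotangent bundle. -/
abbrev Cot (x : M) : Type _ := TangentSpace 𝓘(ℝ, E) x →L[ℝ] ℝ

/-- `X(f)` at all tangent vectors at `x`: the differential `df` of a function, as a `1`-form. -/
def dFun (f : M → ℝ) (x : M) : Cot E x := mfderiv 𝓘(ℝ, E) 𝓘(ℝ, ℝ) f x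

/-! ### Algebroids

Sections of a bundle `V` are functions `s : ∀ x, V x`; operations are only constrained on the smooth
ones. -/

section Algebroid

variable [IsManifold 𝓘(ℝ, E) ∞ M]
  {F : Type*} [NormedAddCommGroup F] [NormedSpace ℝ F]
  {V : M → Type*} [TopologicalSpace (TotalSpace F V)]
  [∀ x, AddCommGroup (V x)] [∀ x, Module ℝ (V x)] [∀ x, TopologicalSpace (V x)]
  [FiberBundle F V]
  {F' : Type*} [NormedAddCommGroup F'] [NormedSpace ℝ F']
  {V' : M → Type*} [TopologicalSpace (TotalSpace F' V')]
  [∀ x, AddCommGroup (V' x)] [∀ x, Module ℝ (V' x)] [∀ x, TopologicalSpace (V' x)]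
  [FiberBundle F' V']

variable (E F) in
/-- `s ∈ Γ(V)`: the section `s` is smooth. -/
def SmoothSection (s : ∀ x, V x) : Prop :=
  ContMDiff 𝓘(ℝ, E) (𝓘(ℝ, E).prod 𝓘(ℝ, F)) ∞ (fun x : M => TotalSpace.mk' F x (s x))

variable (E F F') in
/-- The family of linear maps `Φ x : V x → V' x` is a morphism of (smooth) vector bundles over the
identity of `M`: the map that it induces on total spaces is smooth. -/
def IsBundleMorphism (Φ : ∀ x, V x →ₗ[ℝ] V' x) : Prop :=
  ContMDiff (𝓘(ℝ, E).prod 𝓘(ℝ, F)) (𝓘(ℝ, E).prod 𝓘(ℝ, F')) ∞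
    (fun p : TotalSpace F V => TotalSpace.mk' F' p.proj (Φ p.proj p.snd))

variable (F) in
/-- `(V, ρ, br)` is a skew algebroid: `ρ : V → TM` is a vector bundle morphism and `br` is an
alternating `ℝ`-bilinear map `Γ(V) × Γ(V) → Γ(V)` such that
`br s (φ t) = φ br s t + ρ(s)(φ) t`. -/
structure IsSkewAlgebroid (ρ : ∀ x, V x →ₗ[ℝ] Tan E x)
    (br : (∀ x, V x) → (∀ x, V x) → ∀ x, V x) : Prop where
  anchor : IsBundleMorphism E F E ρ
  smooth : ∀ s t, SmoothSection E F s → SmoothSection E F t → SmoothSection E F (br s t)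
  add_left : ∀ s s' t, SmoothSection E F s → SmoothSection E F s' → SmoothSection E F t →
    br (fun x => s x + s' x) t = fun x => br s t x + br s' t x
  smul_left : ∀ (c : ℝ) s t, SmoothSection E F s → SmoothSection E F t →
    br (fun x => c • s x) t = fun x => c • br s t x
  add_right : ∀ s t t', SmoothSection E F s → SmoothSection E F t → SmoothSection E F t' →
    br s (fun x => t x + t' x) = fun x => br s t x + br s t' x
  smul_right : ∀ (c : ℝ) s t, SmoothSection E F s → SmoothSection E F t →
    br s (fun x => c • t x) = fun x => c • br s t x
  alternating : ∀ s, SmoothSection E F s → br s s = fun _ => 0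
  leibniz : ∀ (φ : M → ℝ) s t, ContMDiff 𝓘(ℝ, E) 𝓘(ℝ, ℝ) ∞ φ →
    SmoothSection E F s → SmoothSection E F t →
    br s (fun x => φ x • t x) = fun x => φ x • br s t x + dFun φ x (ρ x (s x)) • t x

variable (F) in
/-- `(V, ρ, br)` is a Lie algebroid: a skew algebroid whose bracket satisfies the Jacobi identity. -/
structure IsLieAlgebroid (ρ : ∀ x, V x →ₗ[ℝ] Tan E x)
    (br : (∀ x, V x) → (∀ x, V x) → ∀ x, V x) : Prop extends IsSkewAlgebroid F ρ br where
  jacobi : ∀ s t r, SmoothSection E F s → SmoothSection E F t → SmoothSection E F r →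
    (fun x => br s (br t r) x + br t (br r s) x + br r (br s t) x) = fun _ => 0

variable (F F') in
/-- The family of linear isomorphisms `Φ x : V x ≃ V' x` is an isomorphism of algebroids
`(V, ρ, br) → (V', ρ', br')`: an isomorphism of vector bundles over the identity of `M` that
commutes with the anchors and with the brackets of sections. -/
structure IsAlgebroidIso (ρ : ∀ x, V x →ₗ[ℝ] Tan E x)
    (br : (∀ x, V x) → (∀ x, V x) → ∀ x, V x)
    (ρ' : ∀ x, V' x →ₗ[ℝ] Tan E x) (br' : (∀ x, V' x) → (∀ x, V' x) → ∀ x, V' x)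
    (Φ : ∀ x, V x ≃ₗ[ℝ] V' x) : Prop where
  smooth : IsBundleMorphism E F F' (fun x => (Φ x : V x →ₗ[ℝ] V' x))
  smooth_symm : IsBundleMorphism E F' F (fun x => ((Φ x).symm : V' x →ₗ[ℝ] V x))
  anchor : ∀ x v, ρ' x (Φ x v) = ρ x v
  bracket : ∀ s t, SmoothSection E F s → SmoothSection E F t →
    (fun x => Φ x (br s t x)) = br' (fun x => Φ x (s x)) (fun x => Φ x (t x))

end Algebroid

/-! ### Differential calculus of `1`-forms -/

/-- `η` is a smooth `1`-form, `η ∈ Ω¹(M)`. -/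
def IsOneForm [IsManifold 𝓘(ℝ, E) ∞ M] (η : ∀ x : M, Cot E x) : Prop :=
  SmoothSection E (E →L[ℝ] ℝ) (V := fun x : M => TangentSpace 𝓘(ℝ, E) x →L[ℝ] ℝ) η

/-- The coordinate expression of a `1`-form in the preferred chart at `x₀`, that is, its pullback by
the inverse of the chart, written as an alternating form of degree one on `E`. -/
def chartForm (η : ∀ x : M, Cot E x) (x₀ : M) (z : E) : E [⋀^Fin 1]→L[ℝ] ℝ :=
  ContinuousAlternatingMap.ofSubsingleton ℝ E ℝ (0 : Fin 1)
    ((η ((extChartAt 𝓘(ℝ, E) x₀).symm z)).comp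
      (mfderiv 𝓘(ℝ, E) 𝓘(ℝ, E) (extChartAt 𝓘(ℝ, E) x₀).symm z))

/-- The exterior derivative of a `1`-form at `x`, computed in the preferred chart at `x`; the
normalisation is `dη(X, Y) = X(η(Y)) - Y(η(X)) - η([X, Y])`. -/
def extD (η : ∀ x : M, Cot E x) (x : M) : (Tan E x) [⋀^Fin 2]→L[ℝ] ℝ :=
  (extDeriv (chartForm η x) (extChartAt 𝓘(ℝ, E) x x)).compContinuousLinearMap
    (mfderiv 𝓘(ℝ, E) 𝓘(ℝ, E) (extChartAt 𝓘(ℝ, E) x) x)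

theorem update_pair {V : Type*} (u v v' : V) : Function.update ![u, v] 1 v' = ![u, v'] := by
  ext i; fin_cases i <;> rfl

/-- The interior product `i_u w = w(u, ·)`. -/
def contract {x : M} (w : (Tan E x) [⋀^Fin 2]→L[ℝ] ℝ) : Tan E x →ₗ[ℝ] Cot E x where
  toFun u :=
    { toFun := fun v => w ![u, v]
      map_add' := fun v v' => by
        simpa [update_pair] using w.map_update_add ![u, 0] 1 v v'
      map_smul' := fun c v => by
        simpa [update_pair] using w.map_update_smul ![u, 0] 1 c v
      cont := by
        refine w.cont.comp (continuous_pi fun i => ?_)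
        fin_cases i
        · exact continuous_const
        · exact continuous_id }
  map_add' u u' := by
    ext v
    exact w.toMultilinearMap.cons_add ![v] u u'
  map_smul' c u := by
    ext v
    exact w.toMultilinearMap.cons_smul ![v] c u

/-- The Lie derivative of a `1`-form along a vector field, `L_X β = i_X dβ + d(β(X))`; equivalently
`(L_X β)(Y) = X(β(Y)) - β([X, Y])`. -/
def lieDer (X : ∀ x : M, Tan E x) (β : ∀ x : M, Cot E x) (x : M) : Cot E x :=
  contract (extD β x) (X x) + dFun (fun y => β y (X y)) x

/-! ### The skew algebroid of a triple `(P, ξ, lam)`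

`P` is a bivector field, that is, `P x` is an alternating bilinear form on `T*_x M`. -/

section Triple

variable [FiniteDimensional ℝ E]

variable (E) in
/-- The `i`-th vector of a basis of `T_x M`. -/
def basisVec (x : M) (i : Fin (Module.finrank ℝ E)) : Tan E x := (Module.finBasis ℝ E i : E)

variable (E) in
/-- The `i`-th covector of the dual basis of `T*_x M`. -/
def basisCovec (x : M) (i : Fin (Module.finrank ℝ E)) : Cot E x :=
  (LinearMap.toContinuousLinearMap ((Module.finBasis ℝ E).coord i) : E →L[ℝ] ℝ)

theorem sum_basisCovec (x : M) (β : Cot E x) :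
    β = ∑ i, β (basisVec E x i) • basisCovec E x i := by
  ext v
  have hv : ∑ i, basisCovec E x i v • basisVec E x i = v := (Module.finBasis ℝ E).sum_repr (v : E)
  conv_lhs => rw [← hv]
  rw [map_sum]
  simp only [map_smul, smul_eq_mul, sum_apply, smul_apply, mul_comm]

/-- The morphism `♯_P`, with `β(♯_P(α)) = P(α, β)`; the components of `♯_P(α)` in a basis of `T_x M`
are the values of `P(α, ·)` at the dual basis. -/
def sharpBiv (P : ∀ x : M, (Cot E x) [⋀^Fin 2]→ₗ[ℝ] ℝ) (x : M) : Cot E x →ₗ[ℝ] Tan E x where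
  toFun α := ∑ i, P x ![α, basisCovec E x i] • basisVec E x i
  map_add' α α' := by
    have h' : ∀ v : Cot E x, P x ![α + α', v] = P x ![α, v] + P x ![α', v] :=
      fun v => (P x).toMultilinearMap.cons_add ![v] α α'
    simp only [h', add_smul, Finset.sum_add_distrib]
  map_smul' c α := by
    have h' : ∀ v : Cot E x, P x ![c • α, v] = c • P x ![α, v] :=
      fun v => (P x).toMultilinearMap.cons_smul ![v] c α
    simp only [h', smul_assoc, Finset.smul_sum, RingHom.id_apply]

theorem apply_sharpBiv (P : ∀ x : M, (Cot E x) [⋀^Fin 2]→ₗ[ℝ] ℝ) (x : M) (α β : Cot E x) :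
    β (sharpBiv P x α) = P x ![α, β] := by
  let L : Cot E x →ₗ[ℝ] ℝ := (P x).toMultilinearMap.toLinearMap ![α, 0] 1
  have hL : ∀ v, L v = P x ![α, v] := fun v => congrArg (P x) (update_pair α 0 v)
  have h : L β = ∑ i, β (basisVec E x i) • L (basisCovec E x i) := by
    conv_lhs => rw [sum_basisCovec x β]
    simp only [map_sum, map_smul]
  rw [← hL, h]
  simp only [sharpBiv, LinearMap.coe_mk, AddHom.coe_mk, map_sum, map_smul, hL, smul_eq_mul,
    mul_comm]

/-- The anchor `♯_{P,ξ}(α) = ♯_P(α) + α(ξ) ξ`. -/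
def anchor (P : ∀ x : M, (Cot E x) [⋀^Fin 2]→ₗ[ℝ] ℝ) (ξ : ∀ x : M, Tan E x) (x : M) :
    Cot E x →ₗ[ℝ] Tan E x where
  toFun α := sharpBiv P x α + α (ξ x) • ξ x
  map_add' α α' := by
    rw [map_add, add_apply, add_smul]; abel
  map_smul' c α := by
    rw [map_smul, smul_apply, smul_assoc, RingHom.id_apply, smul_add]

/-- The Koszul bracket `[α, β]_P = L_{♯_P(α)} β - L_{♯_P(β)} α - d(P(α, β))`. -/
def koszulBracket (P : ∀ x : M, (Cot E x) [⋀^Fin 2]→ₗ[ℝ] ℝ) (α β : ∀ x : M, Cot E x) (x : M) :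
    Cot E x :=
  lieDer (fun y => sharpBiv P y (α y)) β x - lieDer (fun y => sharpBiv P y (β y)) α x
    - dFun (fun y => P y ![α y, β y]) x

/-- The bracket
`[α, β]^lam_{P,ξ} = [α, β]_P + α(ξ) (L_ξ β - β) - β(ξ) (L_ξ α - α) - P(α, β) lam`. -/
def bracket (P : ∀ x : M, (Cot E x) [⋀^Fin 2]→ₗ[ℝ] ℝ) (ξ : ∀ x : M, Tan E x)
    (lam : ∀ x : M, Cot E x) (α β : ∀ x : M, Cot E x) (x : M) : Cot E x :=
  koszulBracket P α β x + α x (ξ x) • (lieDer ξ β x - β x) - β x (ξ x) • (lieDer ξ α x - α x)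
    - P x ![α x, β x] • lam x

end Triple

/-! ### Contact forms -/

/-- `η` is a contact form on a manifold of dimension `2n+1`: a smooth `1`-form such that the
`(2n+1)`-form `η ∧ (dη)^n` is a volume form, i.e. vanishes nowhere. -/
structure IsContactForm [IsManifold 𝓘(ℝ, E) ∞ M] (n : ℕ) (η : ∀ x : M, Cot E x) : Prop where
  smooth : IsOneForm η
  volume : ∀ x : M,
    wedge (AlternatingMap.ofSubsingleton ℝ (Tan E x) ℝ (0 : Fin 1) (η x).toLinearMap)
      (wedgePow (extD η x).toAlternatingMap n) ≠ 0

/-- `♭_η(X) = - i_X dη + η(X) η`. -/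
def flatEta (η : ∀ x : M, Cot E x) (x : M) : Tan E x →ₗ[ℝ] Cot E x :=
  -contract (extD η x) + (η x).toLinearMap.smulRight (η x)

open Classical in
/-- `♯_η`, the inverse of `♭_η` (zero at the points at which `♭_η` is not invertible). -/
def sharpEta (η : ∀ x : M, Cot E x) (x : M) : Cot E x →ₗ[ℝ] Tan E x :=
  if h : Function.Bijective (flatEta η x) then (LinearEquiv.ofBijective (flatEta η x) h).symm else 0

/-- The bivector field `P(α, β) = dη(♯_η(α), ♯_η(β))` of a contact form. -/
def contactBiv (η : ∀ x : M, Cot E x) (x : M) : (Cot E x) [⋀^Fin 2]→ₗ[ℝ] ℝ :=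
  (extD η x).toAlternatingMap.compLinearMap (sharpEta η x)

/-- The vector field `ξ = ♯_η(η)` of a contact form. -/
def reeb (η : ∀ x : M, Cot E x) (x : M) : Tan E x := sharpEta η x (η x)

end ContactAlgebroid

end

open Bundle Set Filter
open scoped Manifold ContDiff Topology Bundle

noncomputable section

/-! The bracket of `1`-forms is the Lie bracket of vector fields carried over by `♭_η`: `[♭X, ♭Y] =
♭[X, Y]` for smooth `X`, `Y` (`IsContactForm.bracket_flatEta`). Once `♭_η` is known to be a smooth
bundle isomorphism, each axiom of a Lie algebroid reduces to the same axiom for `TM`, and `♯_η` is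
the required isomorphism.

Pointwise, the volume condition gives `ker η ∩ ker dη = 0`. Since `♭(v)(v) = η(v)²`, the map `♭_η`
is injective. In odd dimension `dη` has a nonzero kernel vector, which must be a multiple of `ξ`;
this yields `η(ξ) = 1` and `i_ξ dη = 0`. Hence `♯_π(♭X) = X - η(X)ξ`, and adding `η(X)ξ` shows that
the anchor inverts `♭_η`.

In the bracket of `♭X` and `♭Y` the contractions with `ξ` then cancel, leaving `i_X d(♭Y) - i_Y
d(♭X) + d(dη(X, Y))` and terms weighted by `η`. Evaluating on a field `Z` and expanding every `d` by
`extD_apply` reduces the claim to `d(dη)(X, Y, Z) = 0` (`extD_closed`). -/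

namespace ContactAlgebroid

/-! ### Vector fields and `1`-forms in charts; the invariant formula for `dβ`. -/

section ManifoldCalculus

variable {E : Type*} [NormedAddCommGroup E] [NormedSpace ℝ E]
  {M : Type*} [TopologicalSpace M] [ChartedSpace E M]

/-- The coordinate expression of a vector field in the preferred chart at `x`. -/
def chartField (X : ∀ x : M, Tan E x) (x : M) (z : E) : E :=
  (mfderiv 𝓘(ℝ, E) 𝓘(ℝ, E) (extChartAt 𝓘(ℝ, E) x).symm z).inverse
    (X ((extChartAt 𝓘(ℝ, E) x).symm z))

theorem mpullbackWithin_eq_chartField (X : ∀ x : M, Tan E x) (x : M) :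
    VectorField.mpullbackWithin 𝓘(ℝ, E) 𝓘(ℝ, E) (extChartAt 𝓘(ℝ, E) x).symm X
      (range 𝓘(ℝ, E)) = chartField X x := by
  ext z
  simp [VectorField.mpullbackWithin, chartField, mfderivWithin_univ]

variable [IsManifold 𝓘(ℝ, E) ∞ M]

/-- `X` is a smooth vector field. -/
abbrev IsVectorField (X : ∀ x : M, Tan E x) : Prop :=
  SmoothSection E E (V := fun x : M => TangentSpace 𝓘(ℝ, E) x) X

theorem IsOneForm.contMDiff_apply {β : ∀ x : M, Cot E x} {X : ∀ x : M, Tan E x}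
    (hβ : IsOneForm β) (hX : IsVectorField X) :
    ContMDiff 𝓘(ℝ, E) 𝓘(ℝ, ℝ) ∞ (fun x => β x (X x)) := by
  have h : ContMDiff 𝓘(ℝ, E) (𝓘(ℝ, E).prod 𝓘(ℝ, ℝ)) ∞
      (fun x => TotalSpace.mk' ℝ (E := Bundle.Trivial M ℝ) x (β x (X x))) :=
    ContMDiff.clm_bundle_apply (F₁ := E) (F₂ := ℝ) (E₁ := fun x : M => TangentSpace 𝓘(ℝ, E) x)
      (E₂ := Bundle.Trivial M ℝ) (b := fun x => x) hβ hX
  intro x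
  have := (contMDiffAt_totalSpace.1 (h x)).2
  simpa using this

theorem contMDiff_dFun_apply {f : M → ℝ} {X : ∀ x : M, Tan E x}
    (hf : ContMDiff 𝓘(ℝ, E) 𝓘(ℝ, ℝ) ∞ f) (hX : IsVectorField X) :
    ContMDiff 𝓘(ℝ, E) 𝓘(ℝ, ℝ) ∞ (fun x => dFun f x (X x)) := by
  have h := (hf.contMDiff_tangentMap (m := ∞) (by simp)).comp hX
  exact (contMDiff_snd_tangentBundle_modelSpace ℝ 𝓘(ℝ, ℝ)).comp h

/-- Multiplying by a bump function supported in `u` and equal to `1` near `x` globalises a local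
field, so that identities proved for global fields can be used pointwise. -/
theorem exists_isVectorField_eventuallyEq [FiniteDimensional ℝ E] [T2Space M] (x : M)
    (X : ∀ x : M, Tan E x) {u : Set M} (hu : IsOpen u) (hx : x ∈ u)
    (hX : ContMDiffOn 𝓘(ℝ, E) (𝓘(ℝ, E).prod 𝓘(ℝ, E)) ∞
      (fun x : M => TotalSpace.mk' E (E := fun x : M => TangentSpace 𝓘(ℝ, E) x) x (X x)) u) :
    ∃ Y : ∀ x : M, Tan E x, IsVectorField Y ∧ ∀ᶠ y in 𝓝 x, Y y = X y := by
  obtain ⟨f, -, hf⟩ := (SmoothBumpFunction.nhds_basis_tsupport (I := 𝓘(ℝ, E)) x).mem_iff.1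
    (hu.mem_nhds hx)
  refine ⟨(f : M → ℝ) • X, ?_, ?_⟩
  · exact ContMDiffOn.smul_section_of_tsupport (V := fun x : M => TangentSpace 𝓘(ℝ, E) x)
      f.contMDiff.contMDiffOn hu hf hX
  · filter_upwards [f.eventuallyEq_one] with y hy
    simp [hy]

/-- These fields have constant coordinates near `x`; evaluating a tensor on them reads off its
components in the trivialization. -/
theorem exists_isVectorField_eq_symmL [FiniteDimensional ℝ E] [T2Space M] (x : M) (v : E) :
    ∃ Y : ∀ x : M, Tan E x, IsVectorField Y ∧
      ∀ᶠ y in 𝓝 x, Y y =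
        (trivializationAt E (fun x : M => TangentSpace 𝓘(ℝ, E) x) x).symmL ℝ y v := by
  refine exists_isVectorField_eventuallyEq x _
    (trivializationAt E (fun x : M => TangentSpace 𝓘(ℝ, E) x) x).open_baseSet
    (FiberBundle.mem_baseSet_trivializationAt E (fun x : M => TangentSpace 𝓘(ℝ, E) x) x) ?_
  intro y hy
  rw [Bundle.Trivialization.contMDiffWithinAt_section _ hy]
  have h : ContMDiffOn 𝓘(ℝ, E) 𝓘(ℝ, E) ∞ (fun _ : M => v)
    (trivializationAt E (fun x : M => TangentSpace 𝓘(ℝ, E) x) x).baseSet := contMDiffOn_const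
  exact h.congr (fun z hz => by
    rw [Bundle.Trivialization.symmL_apply _ hz, Bundle.Trivialization.apply_mk_symm _ hz]) y hy

theorem exists_isVectorField_apply_eq [FiniteDimensional ℝ E] [T2Space M] (x : M) (v : Tan E x) :
    ∃ Y : ∀ x : M, Tan E x, IsVectorField Y ∧ Y x = v := by
  obtain ⟨s, hs, h⟩ := FiberBundle.exists_contMDiffOn_extend (k := ∞) 𝓘(ℝ, E) E
    (V := fun x : M => TangentSpace 𝓘(ℝ, E) x) v
  obtain ⟨u, hus, hu, hx⟩ := mem_nhds_iff.1 hs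
  obtain ⟨Y, hY, hYx⟩ := exists_isVectorField_eventuallyEq x _ hu hx (h.mono hus)
  exact ⟨Y, hY, by simpa using hYx.self_of_nhds⟩

theorem mfderiv_extChartAt_symm_isInvertible {x : M} {z : E}
    (hz : z ∈ (extChartAt 𝓘(ℝ, E) x).target) :
    (mfderiv 𝓘(ℝ, E) 𝓘(ℝ, E) (extChartAt 𝓘(ℝ, E) x).symm z).IsInvertible := by
  have h := isInvertible_mfderivWithin_extChartAt_symm (I := 𝓘(ℝ, E)) (𝕜 := ℝ) hz
  simpa [mfderivWithin_univ] using h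

theorem mfderiv_symm_chartField (X : ∀ x : M, Tan E x) {x : M} {z : E}
    (hz : z ∈ (extChartAt 𝓘(ℝ, E) x).target) :
    mfderiv 𝓘(ℝ, E) 𝓘(ℝ, E) (extChartAt 𝓘(ℝ, E) x).symm z (chartField (E := E) X x z) =
      X ((extChartAt 𝓘(ℝ, E) x).symm z) := by
  obtain ⟨A, hA⟩ := mfderiv_extChartAt_symm_isInvertible hz
  rw [chartField, ← hA]
  erw [ContinuousLinearMap.inverse_equiv]
  exact A.apply_symm_apply _

theorem chartField_self (X : ∀ x : M, Tan E x) (x : M) :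
    chartField X x (extChartAt 𝓘(ℝ, E) x x) = X x := by
  have h := mfderivWithin_extChartAt_symm_inverse_apply (I := 𝓘(ℝ, E)) (𝕜 := ℝ) (X x)
  simp only [ModelWithCorners.range_eq_univ, mfderivWithin_univ] at h
  rw [chartField, extChartAt_to_inv]
  exact h

theorem differentiableAt_chartField [CompleteSpace E] {X : ∀ x : M, Tan E x} (hX : IsVectorField X)
    (x : M) : DifferentiableAt ℝ (chartField X x) (extChartAt 𝓘(ℝ, E) x x) := by
  have : IsManifold 𝓘(ℝ, E) 2 M := IsManifold.of_le (n := ∞) (by norm_cast)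
  have h := MDifferentiableWithinAt.differentiableWithinAt_mpullbackWithin_vectorField
    (I := 𝓘(ℝ, E)) (V := X) (x := x) (s := univ)
    ((hX x).mdifferentiableAt (by simp)).mdifferentiableWithinAt
  rw [mpullbackWithin_eq_chartField] at h
  simpa [differentiableWithinAt_univ] using h

/-- No pushforward appears on the right because the preferred chart at `x` has identity derivative
at `x`. -/
theorem mlieBracket_eq_lieBracket (X Y : ∀ x : M, Tan E x) (x : M) :
    VectorField.mlieBracket 𝓘(ℝ, E) X Y x =
      VectorField.lieBracket ℝ (chartField X x) (chartField Y x) (extChartAt 𝓘(ℝ, E) x x) := by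
  rw [← VectorField.mlieBracketWithin_univ, VectorField.mlieBracketWithin_apply,
    mpullbackWithin_eq_chartField, mpullbackWithin_eq_chartField]
  erw [mfderiv_extChartAt_self]
  simp only [preimage_univ, ModelWithCorners.range_eq_univ, inter_univ]
  erw [ContinuousLinearMap.inverse_id]
  rw [VectorField.lieBracketWithin_univ]
  rfl

theorem mdifferentiableAt_extChartAt_symm {x : M} {z : E}
    (hz : z ∈ (extChartAt 𝓘(ℝ, E) x).target) :
    MDifferentiableAt 𝓘(ℝ, E) 𝓘(ℝ, E) (extChartAt 𝓘(ℝ, E) x).symm z := by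
  have h := mdifferentiableWithinAt_extChartAt_symm (I := 𝓘(ℝ, E)) (𝕜 := ℝ) hz
  simpa [mdifferentiableWithinAt_univ] using h

theorem dFun_eq_fderiv {f : M → ℝ} {x : M} {z : E} (hz : z ∈ (extChartAt 𝓘(ℝ, E) x).target)
    (hf : ContMDiff 𝓘(ℝ, E) 𝓘(ℝ, ℝ) ∞ f) (X : ∀ x : M, Tan E x) :
    dFun f ((extChartAt 𝓘(ℝ, E) x).symm z) (X ((extChartAt 𝓘(ℝ, E) x).symm z)) =
      fderiv ℝ (f ∘ (extChartAt 𝓘(ℝ, E) x).symm) z (chartField X x z) := by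
  rw [← mfderiv_symm_chartField X hz, ← mfderiv_eq_fderiv, mfderiv_comp z
    ((hf _).mdifferentiableAt (by simp)) (mdifferentiableAt_extChartAt_symm hz)]
  rfl

theorem dFun_eq_fderiv_self {f : M → ℝ} (hf : ContMDiff 𝓘(ℝ, E) 𝓘(ℝ, ℝ) ∞ f)
    (X : ∀ x : M, Tan E x) (x : M) :
    dFun f x (X x) =
      fderiv ℝ (f ∘ (extChartAt 𝓘(ℝ, E) x).symm) (extChartAt 𝓘(ℝ, E) x x) (X x) := by
  have h := dFun_eq_fderiv (mem_extChartAt_target x) hf X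
  rwa [chartField_self, extChartAt_to_inv] at h

/-- In the chart at `x` this is the symmetry of the second derivative of `f`. -/
theorem dFun_mlieBracket [CompleteSpace E] {f : M → ℝ} (hf : ContMDiff 𝓘(ℝ, E) 𝓘(ℝ, ℝ) ∞ f)
    {X Y : ∀ x : M, Tan E x} (hX : IsVectorField X) (hY : IsVectorField Y) (x : M) :
    dFun f x (VectorField.mlieBracket 𝓘(ℝ, E) X Y x) =
      dFun (fun y => dFun f y (Y y)) x (X x) - dFun (fun y => dFun f y (X y)) x (Y x) := by
  have hsm : ContDiffAt ℝ ∞ (f ∘ (extChartAt 𝓘(ℝ, E) x).symm) (extChartAt 𝓘(ℝ, E) x x) := by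
    have h := (contMDiffOn_extChartAt_symm (I := 𝓘(ℝ, E)) (n := ∞) x).contMDiffAt
      (extChartAt_target_mem_nhds x)
    exact ((hf _).comp _ h).contDiffAt
  have hev : ∀ {Z : ∀ x : M, Tan E x},
      (fun y => dFun f y (Z y)) ∘ (extChartAt 𝓘(ℝ, E) x).symm
        =ᶠ[𝓝 (extChartAt 𝓘(ℝ, E) x x)]
      fun z => fderiv ℝ (f ∘ (extChartAt 𝓘(ℝ, E) x).symm) z (chartField Z x z) := fun {Z} => by
    filter_upwards [extChartAt_target_mem_nhds (I := 𝓘(ℝ, E)) x] with z hz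
    exact dFun_eq_fderiv hz hf Z
  rw [dFun_eq_fderiv_self hf, dFun_eq_fderiv_self (contMDiff_dFun_apply hf hY),
    dFun_eq_fderiv_self (contMDiff_dFun_apply hf hX), mlieBracket_eq_lieBracket,
    hev.fderiv_eq, hev.fderiv_eq]
  have := VectorField.fderiv_apply_lieBracket hsm (by simp; norm_cast)
    (differentiableAt_chartField hY x) (differentiableAt_chartField hX x)
  rwa [chartField_self, chartField_self] at this

/-- Near the base point the derivative of the inverse chart is the inverse of the tangent
trivialization, so the chart form is the smooth local representative of `β`. -/
theorem differentiableAt_chartForm {β : ∀ x : M, Cot E x} (hβ : IsOneForm β) (x : M) :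
    DifferentiableAt ℝ (chartForm β x) (extChartAt 𝓘(ℝ, E) x x) := by
  have h := ((contMDiffAt_hom_bundle _).1 (hβ x)).2
  have hs := (contMDiffOn_extChartAt_symm (I := 𝓘(ℝ, E)) (n := ∞) x).contMDiffAt
    (extChartAt_target_mem_nhds x)
  have h' := (ContMDiffAt.comp_of_eq h hs (by simp)).contDiffAt.differentiableAt (by simp)
  have h2 := (ContinuousAlternatingMap.ofSubsingletonLIE
    (0 : Fin 1)).toContinuousLinearEquiv.differentiableAt.comp _ h'
  refine h2.congr_of_eventuallyEq ?_
  filter_upwards [extChartAt_target_mem_nhds (I := 𝓘(ℝ, E)) x] with z hz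
  have hz' : (extChartAt 𝓘(ℝ, E) x).symm z ∈ (chartAt E x).source := by
    simpa using (extChartAt 𝓘(ℝ, E) x).map_target hz
  have hsymm := TangentBundle.symmL_trivializationAt (I := 𝓘(ℝ, E)) (𝕜 := ℝ) hz'
  rw [(extChartAt 𝓘(ℝ, E) x).right_inv hz] at hsymm
  simp only [ModelWithCorners.range_eq_univ, mfderivWithin_univ] at hsymm
  simp only [chartForm, Function.comp, ContinuousLinearMap.inCoordinates]
  ext v
  erw [hsymm]
  simp

/-- The formula holds for `extDeriv` and the chart fields on `E`. It transfers to `M` because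
pairings, derivatives and Lie brackets all agree with their chart expressions. -/
theorem extD_apply [CompleteSpace E] {β : ∀ x : M, Cot E x} (hβ : IsOneForm β)
    {X Y : ∀ x : M, Tan E x} (hX : IsVectorField X) (hY : IsVectorField Y) (x : M) :
    extD β x ![X x, Y x] =
      dFun (fun y => β y (Y y)) x (X x) - dFun (fun y => β y (X y)) x (Y x) -
        β x (VectorField.mlieBracket 𝓘(ℝ, E) X Y x) := by
  have hev : ∀ {Z : ∀ x : M, Tan E x},
      (fun y => β y (Z y)) ∘ (extChartAt 𝓘(ℝ, E) x).symm
        =ᶠ[𝓝 (extChartAt 𝓘(ℝ, E) x x)]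
      fun z => chartForm β x z ![chartField Z x z] := fun {Z} => by
    filter_upwards [extChartAt_target_mem_nhds (I := 𝓘(ℝ, E)) x] with z hz
    simp only [Function.comp, chartForm]
    rw [← mfderiv_symm_chartField Z hz]
    rfl
  have hd : ∀ i, DifferentiableAt ℝ ((![chartField X x, chartField Y x] : Fin 2 → E → E) i)
      (extChartAt 𝓘(ℝ, E) x x) := by
    intro i
    fin_cases i
    exacts [differentiableAt_chartField hX x, differentiableAt_chartField hY x]
  have h := extDeriv_apply_vectorField (differentiableAt_chartForm hβ x) hd
  have hp : ∀ y, (fun i : Fin 2 => (![chartField X x, chartField Y x] : Fin 2 → E → E) i y) =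
      ![chartField X x y, chartField Y x y] := fun y => by ext i; fin_cases i <;> rfl
  -- The general formula sums over arguments with one or two entries removed; for a form of degree
  -- one these sums collapse as follows.
  have h0 : ∀ a b : E, (0 : Fin 2).removeNth (α := fun _ => E) ![a, b] = ![b] := fun a b => by
    ext i; fin_cases i; rfl
  have h1 : ∀ a b : E, (1 : Fin 2).removeNth (α := fun _ => E) ![a, b] = ![a] := fun a b => by
    ext i; fin_cases i; rfl
  have h2 : ∀ a : E, ∀ f : Fin 0 → E, (Matrix.vecCons a f) = ![a] := fun a f => by
    ext i; fin_cases i; rfl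
  have h3 : ∀ j : Fin 1, Finset.Ici j = {0} := by decide
  simp only [hp] at h
  rw [Fin.sum_univ_two] at h
  simp only [h0, h1, h2, h3, Finset.sum_singleton, Fin.sum_univ_succ, Fin.sum_univ_zero] at h
  simp only [Fin.val_zero, Fin.val_one, pow_zero, pow_one, one_smul, neg_smul, add_zero,
    Matrix.cons_val_zero, Matrix.cons_val_one, ← (hev (Z := X)).fderiv_eq,
    ← (hev (Z := Y)).fderiv_eq, ← sub_eq_add_neg, Fin.castSucc_zero, Fin.succ_zero_eq_one,
    chartField_self, Fin.val_eq_zero] at h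
  have hx := (hev (Z := VectorField.mlieBracket 𝓘(ℝ, E) X Y)).self_of_nhds
  simp only [chartField_self, Function.comp] at hx
  rw [extChartAt_to_inv] at hx
  rw [dFun_eq_fderiv_self (hβ.contMDiff_apply hY), dFun_eq_fderiv_self (hβ.contMDiff_apply hX),
    hx, mlieBracket_eq_lieBracket]
  refine Eq.trans ?_ h
  rw [extD]
  erw [mfderiv_extChartAt_self]
  rfl

end ManifoldCalculus

/-! ### Rules for `df`, the Jacobi identity for vector fields, and `d(dβ) = 0`. -/

section FurtherCalculus

variable {E : Type*} [NormedAddCommGroup E] [NormedSpace ℝ E]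
  {M : Type*} [TopologicalSpace M] [ChartedSpace E M]

theorem dFun_add {f g : M → ℝ} (hf : ContMDiff 𝓘(ℝ, E) 𝓘(ℝ, ℝ) ∞ f)
    (hg : ContMDiff 𝓘(ℝ, E) 𝓘(ℝ, ℝ) ∞ g) (x : M) :
    dFun (E := E) (fun y => f y + g y) x = dFun f x + dFun g x :=
  mfderiv_add ((hf x).mdifferentiableAt (by simp)) ((hg x).mdifferentiableAt (by simp))

theorem dFun_neg (f : M → ℝ) (x : M) :
    dFun (E := E) (fun y => -f y) x = -dFun f x :=
  mfderiv_neg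

theorem dFun_sub {f g : M → ℝ} (hf : ContMDiff 𝓘(ℝ, E) 𝓘(ℝ, ℝ) ∞ f)
    (hg : ContMDiff 𝓘(ℝ, E) 𝓘(ℝ, ℝ) ∞ g) (x : M) :
    dFun (E := E) (fun y => f y - g y) x = dFun f x - dFun g x :=
  mfderiv_sub ((hf x).mdifferentiableAt (by simp)) ((hg x).mdifferentiableAt (by simp))

theorem dFun_mul {f g : M → ℝ} (hf : ContMDiff 𝓘(ℝ, E) 𝓘(ℝ, ℝ) ∞ f)
    (hg : ContMDiff 𝓘(ℝ, E) 𝓘(ℝ, ℝ) ∞ g) (x : M) :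
    dFun (E := E) (fun y => f y * g y) x = f x • dFun g x + g x • dFun f x :=
  (((hf x).mdifferentiableAt (by simp)).hasMFDerivAt.mul
    ((hg x).mdifferentiableAt (by simp)).hasMFDerivAt).mfderiv

theorem contract_apply {x : M} (w : (Tan E x) [⋀^Fin 2]→L[ℝ] ℝ) (u v : Tan E x) :
    contract w u v = w ![u, v] := rfl

theorem alternating_swap {x : M} (w : (Tan E x) [⋀^Fin 2]→L[ℝ] ℝ) (u v : Tan E x) :
    w ![v, u] = -w ![u, v] := by
  have h := w.toAlternatingMap.map_swap ![u, v] (show (0 : Fin 2) ≠ 1 by decide)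
  have h' : ![u, v] ∘ Equiv.swap (0 : Fin 2) 1 = ![v, u] := by
    ext i; fin_cases i <;> rfl
  rw [h'] at h
  exact h

theorem alternating_self {x : M} (w : (Tan E x) [⋀^Fin 2]→L[ℝ] ℝ) (u : Tan E x) :
    w ![u, u] = 0 := by
  have h := alternating_swap w u u
  linarith

theorem dFun_extD_swap (η : ∀ x : M, Cot E x) (X Y : ∀ x : M, Tan E x) (x : M) :
    dFun (E := E) (fun y => extD η y ![Y y, X y]) x =
      -dFun (fun y => extD η y ![X y, Y y]) x := by
  rw [← dFun_neg]
  congr 1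
  ext y
  exact alternating_swap _ _ _

variable [IsManifold 𝓘(ℝ, E) ∞ M] [CompleteSpace E]

theorem IsVectorField.mlieBracket {X Y : ∀ x : M, Tan E x} (hX : IsVectorField X)
    (hY : IsVectorField Y) : IsVectorField (VectorField.mlieBracket 𝓘(ℝ, E) X Y) := by
  have : IsManifold 𝓘(ℝ, E) (((⊤ : ℕ∞) : WithTop ℕ∞) + 1) M :=
    IsManifold.of_le (n := ∞) (by norm_cast)
  have : IsManifold 𝓘(ℝ, E) (minSmoothness ℝ 2) M :=
    IsManifold.of_le (n := ∞) (by simp; norm_cast)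
  exact ContDiff.mlieBracket_vectorField (n := ⊤) (m := ⊤) hX hY (by simp)

/-- The chart defining `extD` changes with the point, so smoothness is read off the invariant
formula instead. -/
theorem contMDiff_extD_apply {β : ∀ x : M, Cot E x} (hβ : IsOneForm β)
    {X Y : ∀ x : M, Tan E x} (hX : IsVectorField X) (hY : IsVectorField Y) :
    ContMDiff 𝓘(ℝ, E) 𝓘(ℝ, ℝ) ∞ (fun x => extD β x ![X x, Y x]) := by
  simp only [extD_apply hβ hX hY]
  exact ((contMDiff_dFun_apply (hβ.contMDiff_apply hY) hX).sub
    (contMDiff_dFun_apply (hβ.contMDiff_apply hX) hY)).sub (hβ.contMDiff_apply (hX.mlieBracket hY))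

theorem mlieBracket_jacobi {X Y Z : ∀ x : M, Tan E x} (hX : IsVectorField X)
    (hY : IsVectorField Y) (hZ : IsVectorField Z) (x : M) :
    VectorField.mlieBracket 𝓘(ℝ, E) X (VectorField.mlieBracket 𝓘(ℝ, E) Y Z) x =
      VectorField.mlieBracket 𝓘(ℝ, E) (VectorField.mlieBracket 𝓘(ℝ, E) X Y) Z x +
        VectorField.mlieBracket 𝓘(ℝ, E) Y (VectorField.mlieBracket 𝓘(ℝ, E) X Z) x := by
  have : IsManifold 𝓘(ℝ, E) (minSmoothness ℝ 3) M :=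
    IsManifold.of_le (n := ∞) (by simp; norm_cast)
  have h2 : minSmoothness ℝ 2 ≤ (∞ : WithTop ℕ∞) := by simp; norm_cast
  exact VectorField.leibniz_identity_mlieBracket_apply ((hX x).of_le h2) ((hY x).of_le h2)
    ((hZ x).of_le h2)

theorem mlieBracket_cyclic {X Y Z : ∀ x : M, Tan E x} (hX : IsVectorField X)
    (hY : IsVectorField Y) (hZ : IsVectorField Z) (x : M) :
    VectorField.mlieBracket 𝓘(ℝ, E) X (VectorField.mlieBracket 𝓘(ℝ, E) Y Z) x +
      VectorField.mlieBracket 𝓘(ℝ, E) Y (VectorField.mlieBracket 𝓘(ℝ, E) Z X) x +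
        VectorField.mlieBracket 𝓘(ℝ, E) Z (VectorField.mlieBracket 𝓘(ℝ, E) X Y) x = 0 := by
  have : IsManifold 𝓘(ℝ, E) 2 M := IsManifold.of_le (n := ∞) (by norm_cast)
  -- This pulls the sign out of `[Y, -[X, Z]]`, turning `[Y, [Z, X]]` into the term of the Leibniz
  -- form of the identity.
  have h := VectorField.mlieBracket_const_smul_right (c := (-1 : ℝ)) (V := Y)
    ((hX.mlieBracket hZ x).mdifferentiableAt (by simp))
  rw [neg_one_smul, neg_one_smul, ← VectorField.mlieBracket_swap] at h
  rw [h, mlieBracket_jacobi hX hY hZ, VectorField.mlieBracket_swap_apply (V := Z)]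
  abel

theorem dFun_extD_apply {β : ∀ x : M, Cot E x} (hβ : IsOneForm β)
    {X Y : ∀ x : M, Tan E x} (hX : IsVectorField X) (hY : IsVectorField Y) (x : M) :
    dFun (E := E) (fun x => extD β x ![X x, Y x]) x =
      dFun (fun y => dFun (fun y => β y (Y y)) y (X y)) x -
        dFun (fun y => dFun (fun y => β y (X y)) y (Y y)) x -
          dFun (fun y => β y (VectorField.mlieBracket 𝓘(ℝ, E) X Y y)) x := by
  simp only [extD_apply hβ hX hY]
  have h1 := contMDiff_dFun_apply (hβ.contMDiff_apply hY) hX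
  have h2 := contMDiff_dFun_apply (hβ.contMDiff_apply hX) hY
  rw [dFun_sub (h1.sub h2) (hβ.contMDiff_apply (hX.mlieBracket hY)), dFun_sub h1 h2]

/-- The form `dβ` is closed. -/
theorem extD_closed {β : ∀ x : M, Cot E x} (hβ : IsOneForm β) {X Y Z : ∀ x : M, Tan E x}
    (hX : IsVectorField X) (hY : IsVectorField Y) (hZ : IsVectorField Z) (x : M) :
    dFun (fun y => extD β y ![Y y, Z y]) x (X x) - dFun (fun y => extD β y ![X y, Z y]) x (Y x) +
      dFun (fun y => extD β y ![X y, Y y]) x (Z x) -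
      extD β x ![VectorField.mlieBracket 𝓘(ℝ, E) X Y x, Z x] +
      extD β x ![VectorField.mlieBracket 𝓘(ℝ, E) X Z x, Y x] -
      extD β x ![VectorField.mlieBracket 𝓘(ℝ, E) Y Z x, X x] = 0 := by
  rw [dFun_extD_apply hβ hY hZ, dFun_extD_apply hβ hX hZ, dFun_extD_apply hβ hX hY,
    extD_apply hβ (hX.mlieBracket hY) hZ, extD_apply hβ (hX.mlieBracket hZ) hY,
    extD_apply hβ (hY.mlieBracket hZ) hX, dFun_mlieBracket (hβ.contMDiff_apply hZ) hX hY,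
    dFun_mlieBracket (hβ.contMDiff_apply hY) hX hZ, dFun_mlieBracket (hβ.contMDiff_apply hX) hY hZ]
  -- The second derivatives of `β(X)`, `β(Y)`, `β(Z)` cancel against derivatives along brackets;
  -- what is left is `β` applied to the Jacobi identity.
  have hj := congrArg (β x) (mlieBracket_jacobi hX hY hZ x)
  rw [VectorField.mlieBracket_swap_apply (W := VectorField.mlieBracket 𝓘(ℝ, E) Y Z),
    VectorField.mlieBracket_swap_apply (W := VectorField.mlieBracket 𝓘(ℝ, E) X Z), map_add,
    map_neg, map_neg] at hj
  simp only [sub_apply]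
  linear_combination -hj

end FurtherCalculus

/-! ### Smoothness of bundle maps and of their fibrewise inverses. -/

section BundleMorphisms

variable {E : Type*} [NormedAddCommGroup E] [NormedSpace ℝ E]
  {M : Type*} [TopologicalSpace M] [ChartedSpace E M]

theorem contMDiffAt_clm_of_apply [FiniteDimensional ℝ E] {F : Type*} [NormedAddCommGroup F]
    [NormedSpace ℝ F] {f : M → E →L[ℝ] F} {x : M}
    (h : ∀ v, ContMDiffAt 𝓘(ℝ, E) 𝓘(ℝ, F) ∞ (fun y => f y v) x) :
    ContMDiffAt 𝓘(ℝ, E) 𝓘(ℝ, E →L[ℝ] F) ∞ f x := by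
  let b := Module.finBasis ℝ E
  have hf : f = fun y => ∑ i, ContinuousLinearMap.smulRightL ℝ E F
      (LinearMap.toContinuousLinearMap (b.coord i)) (f y (b i)) := by
    ext y v
    conv_lhs => rw [← b.sum_repr v, map_sum]
    simp
  rw [hf]
  refine ContMDiffAt.sum fun i _ => ?_
  exact (ContinuousLinearMap.smulRightL ℝ E F
    (LinearMap.toContinuousLinearMap (b.coord i))).contMDiff.contMDiffAt.comp x (h (b i))

variable {F : Type*} [NormedAddCommGroup F] [NormedSpace ℝ F]
  {V : M → Type*} [TopologicalSpace (TotalSpace F V)]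
  [∀ x, AddCommGroup (V x)] [∀ x, Module ℝ (V x)] [∀ x, TopologicalSpace (V x)]
  [FiberBundle F V]
  {F' : Type*} [NormedAddCommGroup F'] [NormedSpace ℝ F']
  {V' : M → Type*} [TopologicalSpace (TotalSpace F' V')]
  [∀ x, AddCommGroup (V' x)] [∀ x, Module ℝ (V' x)] [∀ x, TopologicalSpace (V' x)]
  [FiberBundle F' V']

theorem IsBundleMorphism.smoothSection {Φ : ∀ x, V x →ₗ[ℝ] V' x}
    (h : IsBundleMorphism E F F' Φ) {s : ∀ x, V x} (hs : SmoothSection E F s) :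
    SmoothSection E F' (fun x => Φ x (s x)) :=
  ContMDiff.comp h hs

variable [VectorBundle ℝ F V] [VectorBundle ℝ F' V']

theorem isBundleMorphism_of_inCoordinates [ContMDiffVectorBundle ∞ F V 𝓘(ℝ, E)]
    (Φ : ∀ x, V x →L[ℝ] V' x)
    (h : ∀ x, ContMDiffAt 𝓘(ℝ, E) 𝓘(ℝ, F →L[ℝ] F') ∞
      (fun y => ContinuousLinearMap.inCoordinates F V F' V' x y x y (Φ y)) x) :
    IsBundleMorphism E F F' (fun x => (Φ x : V x →ₗ[ℝ] V' x)) := by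
  intro p
  have hp := Bundle.contMDiff_proj (IB := 𝓘(ℝ, E)) (n := ∞) (F := F) V p
  exact ContMDiffAt.clm_apply_of_inCoordinates (b₁ := TotalSpace.proj) (b₂ := TotalSpace.proj)
    (ϕ := fun q : TotalSpace F V => Φ q.proj) (v := fun q : TotalSpace F V => q.snd)
    ((h p.proj).comp p hp) contMDiffAt_id hp

/-- Near `x` the coordinates of the inverse are the inverse operator of the coordinates, and
operator inversion is smooth at invertible operators. -/
theorem contMDiffAt_inCoordinates_symm [CompleteSpace F]
    (Φ : ∀ x, V x ≃L[ℝ] V' x) {x : M}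
    (h : ContMDiffAt 𝓘(ℝ, E) 𝓘(ℝ, F →L[ℝ] F') ∞
      (fun y => ContinuousLinearMap.inCoordinates F V F' V' x y x y (Φ y : V y →L[ℝ] V' y)) x) :
    ContMDiffAt 𝓘(ℝ, E) 𝓘(ℝ, F' →L[ℝ] F) ∞
      (fun y => ContinuousLinearMap.inCoordinates F' V' F V x y x y
        ((Φ y).symm : V' y →L[ℝ] V y)) x := by
  let e := trivializationAt F V x
  let e' := trivializationAt F' V' x
  let A : ∀ y, y ∈ e.baseSet → y ∈ e'.baseSet → F ≃L[ℝ] F' := fun y hy hy' =>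
    ((e.continuousLinearEquivAt ℝ y hy).symm.trans (Φ y)).trans
      (e'.continuousLinearEquivAt ℝ y hy')
  have hx : x ∈ e.baseSet := FiberBundle.mem_baseSet_trivializationAt F V x
  have hx' : x ∈ e'.baseSet := FiberBundle.mem_baseSet_trivializationAt F' V' x
  have hA : ∀ y hy hy', ContinuousLinearMap.inCoordinates F V F' V' x y x y
      (Φ y : V y →L[ℝ] V' y) = A y hy hy' := fun y hy hy' => by
    rw [ContinuousLinearMap.inCoordinates_eq hy hy']; rfl
  have hA' : ∀ y hy hy', ContinuousLinearMap.inCoordinates F' V' F V x y x y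
      ((Φ y).symm : V' y →L[ℝ] V y) = (A y hy hy').symm := fun y hy hy' => by
    rw [ContinuousLinearMap.inCoordinates_eq hy' hy]; rfl
  have hinv : ContDiffAt ℝ ∞ ContinuousLinearMap.inverse (A x hx hx' : F →L[ℝ] F') :=
    contDiffAt_map_inverse _
  rw [← hA] at hinv
  refine (hinv.contMDiffAt.comp x h).congr_of_eventuallyEq ?_
  filter_upwards [e.open_baseSet.mem_nhds hx, e'.open_baseSet.mem_nhds hx'] with y hy hy'
  rw [Function.comp, hA y hy hy', hA' y hy hy', ContinuousLinearMap.inverse_equiv]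

end BundleMorphisms

/-! ### Smoothness of bilinear forms tested on vector fields. -/

section TensorFields

variable {E : Type*} [NormedAddCommGroup E] [NormedSpace ℝ E] [FiniteDimensional ℝ E]
  {M : Type*} [TopologicalSpace M] [T2Space M] [ChartedSpace E M] [IsManifold 𝓘(ℝ, E) ∞ M]

/-- A bilinear form on the fibres of the tangent bundle is smooth if its values on smooth vector
fields are smooth. -/
theorem contMDiffAt_inCoordinates_of_apply (Φ : ∀ x : M, Tan E x →L[ℝ] Cot E x)
    (h : ∀ X Y : ∀ x : M, Tan E x, IsVectorField X → IsVectorField Y →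
      ContMDiff 𝓘(ℝ, E) 𝓘(ℝ, ℝ) ∞ (fun x => Φ x (X x) (Y x))) (x : M) :
    ContMDiffAt 𝓘(ℝ, E) 𝓘(ℝ, E →L[ℝ] E →L[ℝ] ℝ) ∞
      (fun y => ContinuousLinearMap.inCoordinates E (fun x : M => TangentSpace 𝓘(ℝ, E) x)
        (E →L[ℝ] ℝ) (fun x : M => TangentSpace 𝓘(ℝ, E) x →L[ℝ] ℝ) x y x y (Φ y)) x := by
  refine contMDiffAt_clm_of_apply fun v => contMDiffAt_clm_of_apply fun w => ?_
  obtain ⟨X, hX, hXx⟩ := exists_isVectorField_eq_symmL x v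
  obtain ⟨Y, hY, hYx⟩ := exists_isVectorField_eq_symmL x w
  refine (h X Y hX hY x).congr_of_eventuallyEq ?_
  have hx := FiberBundle.mem_baseSet_trivializationAt E (fun x : M => TangentSpace 𝓘(ℝ, E) x) x
  filter_upwards [hXx, hYx, (trivializationAt E (fun x : M => TangentSpace 𝓘(ℝ, E) x)
    x).open_baseSet.mem_nhds hx] with y hXy hYy hy
  rw [hXy, hYy]
  have hy' : y ∈ (trivializationAt (E →L[ℝ] ℝ)
      (fun x : M => TangentSpace 𝓘(ℝ, E) x →L[ℝ] ℝ) x).baseSet := ⟨hy, mem_univ _⟩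
  simp only [ContinuousLinearMap.inCoordinates, ContinuousLinearMap.comp_apply,
    Bundle.Trivialization.continuousLinearMapAt_apply,
    Bundle.Trivialization.coe_linearMapAt_of_mem _ hy']
  erw [hom_trivializationAt_apply]
  simp [ContinuousLinearMap.inCoordinates]

end TensorFields

/-! ### Vectors annihilating a wedge product; degenerate forms in odd dimension. -/

section LinearAlgebra

variable {V : Type*} [AddCommGroup V] [Module ℝ V]

/-- In each shuffle term the argument equal to `v` goes to `a` or to `b`, and either factor then
vanishes. -/
theorem wedge_eq_zero_of_apply_eq {m k : ℕ} {a : V [⋀^Fin m]→ₗ[ℝ] ℝ} {b : V [⋀^Fin k]→ₗ[ℝ] ℝ}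
    {v : V} (ha : ∀ w i, w i = v → a w = 0) (hb : ∀ w i, w i = v → b w = 0)
    (w : Fin (m + k) → V) (i : Fin (m + k)) (hi : w i = v) : wedge a b w = 0 := by
  simp only [wedge, AlternatingMap.domDomCongr_apply, LinearMap.compAlternatingMap_apply,
    AlternatingMap.domCoprod_apply, sum_apply, map_sum]
  refine Finset.sum_eq_zero fun q _ => ?_
  induction q using Quotient.inductionOn' with
  | h σ =>
    rw [AlternatingMap.domCoprod.summand_mk'']
    simp only [smul_apply, MultilinearMap.domDomCongr_apply,
      MultilinearMap.domCoprod_apply]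
    obtain ⟨j, hj⟩ : ∃ j, finSumFinEquiv (σ j) = i := ⟨σ.symm (finSumFinEquiv.symm i), by simp⟩
    rcases j with j | j
    · have h := ha (fun l => w (finSumFinEquiv (σ (Sum.inl l)))) j (by rw [hj, hi])
      erw [h]
      simp
    · have h := hb (fun l => w (finSumFinEquiv (σ (Sum.inr l)))) j (by rw [hj, hi])
      erw [h]
      simp

theorem wedgePow_eq_zero_of_apply_eq {a : V [⋀^Fin 2]→ₗ[ℝ] ℝ} {v : V}
    (ha : ∀ w i, w i = v → a w = 0) (n : ℕ) (w : Fin (2 * n) → V) (i : Fin (2 * n))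
    (hi : w i = v) : wedgePow a n w = 0 := by
  induction n with
  | zero => exact i.elim0
  | succ n ih => exact wedge_eq_zero_of_apply_eq ih ha w i hi

/-- If `a w ≠ 0`, then `w` is a basis. Putting `v` in place of `w j` multiplies `a w` by the `j`-th
coordinate of `v`, so all coordinates vanish. -/
theorem eq_zero_of_forall_apply_eq_zero {m : ℕ} (hV : Module.finrank ℝ V = m) (hm : 0 < m)
    {a : V [⋀^Fin m]→ₗ[ℝ] ℝ} (ha : a ≠ 0) {v : V} (h : ∀ w i, w i = v → a w = 0) : v = 0 := by
  by_contra hv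
  apply ha
  ext w
  by_contra hw
  have hli : LinearIndependent ℝ w := by
    by_contra hli
    exact hw (a.map_linearDependent w hli)
  have : Nonempty (Fin m) := ⟨⟨0, hm⟩⟩
  let b := basisOfLinearIndependentOfCardEqFinrank hli (by simp [hV])
  have hb : ∀ i, b i = w i := fun i => by simp [b]
  obtain ⟨j, hj⟩ : ∃ j, b.repr v j ≠ 0 := by
    by_contra! hall
    exact hv (b.repr.map_eq_zero_iff.1 (Finsupp.ext hall))
  let L := a.toMultilinearMap.toLinearMap w j
  have hL : ∀ u, L u = a (Function.update w j u) := fun u => rfl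
  have h1 : L v = 0 := by
    rw [hL]
    exact h _ j (by simp)
  have h2 : L v = b.repr v j * a w := by
    conv_lhs => rw [← b.sum_repr v]
    rw [map_sum, Finset.sum_eq_single j]
    · rw [map_smul, hb, hL, Function.update_eq_self, smul_eq_mul]
    · intro i _ hij
      rw [map_smul, hb, hL, a.map_update_self _ hij.symm, smul_zero]
    · simp
  rw [h1] at h2
  exact (mul_ne_zero hj hw) h2.symm

/-- An alternating bilinear form on a space of odd dimension is degenerate. -/
theorem exists_ne_zero_of_odd_finrank (hV : Odd (Module.finrank ℝ V)) (B : V →ₗ[ℝ] V →ₗ[ℝ] ℝ)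
    (hB : ∀ u v, B v u = -B u v) : ∃ v, v ≠ 0 ∧ ∀ u, B v u = 0 := by
  have : Module.Finite ℝ V := Module.finite_of_finrank_pos hV.pos
  let b := Module.finBasis ℝ V
  let A : Matrix (Fin (Module.finrank ℝ V)) (Fin (Module.finrank ℝ V)) ℝ :=
    Matrix.of fun i j => B (b i) (b j)
  have hA : A.transpose = -A := by
    ext i j
    exact hB _ _
  -- Skew-symmetry in odd size gives `det A = det Aᵀ = -det A`.
  have hdet : A.det = 0 := by
    have h := A.det_transpose
    rw [hA, Matrix.det_neg, Fintype.card_fin, hV.neg_one_pow] at h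
    linarith
  obtain ⟨c, hc, hAc⟩ := Matrix.exists_vecMul_eq_zero_iff.2 hdet
  refine ⟨∑ i, c i • b i, fun h => hc ?_, fun u => ?_⟩
  · ext i
    exact Fintype.linearIndependent_iff.1 b.linearIndependent c h i
  · have : B (∑ i, c i • b i) = 0 := b.ext fun j => by
      have h := congrFun hAc j
      simpa [Matrix.vecMul, dotProduct, A] using h
    rw [this]; rfl

end LinearAlgebra

/-! ### The isomorphism `♭_η`, the Reeb field, the anchor, and their smoothness. -/

section ContactForms

variable {E : Type*} [NormedAddCommGroup E] [NormedSpace ℝ E]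
  {M : Type*} [TopologicalSpace M] [ChartedSpace E M]

theorem flatEta_apply (η : ∀ x : M, Cot E x) (x : M) (u v : Tan E x) :
    flatEta η x u v = -extD η x ![u, v] + η x u * η x v := rfl

theorem eq_of_forall_cot_apply_eq {x : M} {u v : Tan E x} (h : ∀ β : Cot E x, β u = β v) :
    u = v := by
  by_contra hne
  obtain ⟨β, hβ⟩ := SeparatingDual.exists_separating_of_ne (R := ℝ) (V := E) hne
  exact hβ (h β)

variable (E) in
theorem finrank_dual [FiniteDimensional ℝ E] :
    Module.finrank ℝ (E →L[ℝ] ℝ) = Module.finrank ℝ E := by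
  have h := (LinearMap.toContinuousLinearMap (𝕜 := ℝ) (E := E) (F' := ℝ)).finrank_eq
  exact h.symm.trans Subspace.dual_finrank_eq

variable [IsManifold 𝓘(ℝ, E) ∞ M] {n : ℕ} {η : ∀ x : M, Cot E x}

/-- The volume condition enters the proof only here: a vector in `ker η ∩ ker dη` annihilates the
top form `η ∧ (dη)^n`. -/
theorem IsContactForm.eq_zero (hη : IsContactForm n η) (hdim : Module.finrank ℝ E = 2 * n + 1)
    {x : M} {v : Tan E x} (h₁ : η x v = 0) (h₂ : ∀ u, extD η x ![v, u] = 0) : v = 0 := by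
  refine eq_zero_of_forall_apply_eq_zero (V := Tan E x) (m := 1 + 2 * n)
    (by rw [add_comm]; exact hdim) (by omega) (hη.volume x)
    (wedge_eq_zero_of_apply_eq (fun w i hi => ?_)
      (wedgePow_eq_zero_of_apply_eq (fun w i hi => ?_) n))
  · obtain rfl : i = 0 := Subsingleton.elim _ _
    rw [← h₁, ← hi]
    rfl
  · have hw : w = ![w 0, w 1] := by ext i; fin_cases i <;> rfl
    change extD η x w = 0
    rw [hw]
    fin_cases i
    · rw [show w 0 = v from hi, h₂]
    · rw [show w 1 = v from hi, alternating_swap, h₂, neg_zero]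

theorem IsContactForm.flatEta_bijective [FiniteDimensional ℝ E] (hη : IsContactForm n η)
    (hdim : Module.finrank ℝ E = 2 * n + 1) (x : M) : Function.Bijective (flatEta η x) := by
  have hinj : Function.Injective (flatEta η x) := by
    rw [injective_iff_map_eq_zero]
    intro v hv
    have h : ∀ u, -extD η x ![v, u] + η x v * η x u = 0 := fun u => by
      rw [← flatEta_apply, hv]; rfl
    -- Evaluating `♭(v) = 0` at `v` itself leaves `η(v)² = 0`.
    have h₁ : η x v = 0 := by
      have := h v
      rw [alternating_self, neg_zero, zero_add] at this
      exact mul_self_eq_zero.1 this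
    exact hη.eq_zero hdim h₁ fun u => by simpa [h₁] using h u
  let f : E →ₗ[ℝ] (E →L[ℝ] ℝ) := flatEta η x
  have : FiniteDimensional ℝ (E →L[ℝ] ℝ) :=
    (LinearMap.toContinuousLinearMap (𝕜 := ℝ) (E := E) (F' := ℝ)).finiteDimensional
  exact ⟨hinj, (LinearMap.injective_iff_surjective_of_finrank_eq_finrank (f := f)
    (finrank_dual E).symm).1 hinj⟩

variable [FiniteDimensional ℝ E]

theorem IsContactForm.flatEta_sharpEta (hη : IsContactForm n η)
    (hdim : Module.finrank ℝ E = 2 * n + 1) (x : M) (α : Cot E x) :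
    flatEta η x (sharpEta η x α) = α := by
  have h := hη.flatEta_bijective hdim x
  rw [sharpEta, dif_pos h]
  exact (LinearEquiv.ofBijective (flatEta η x) h).apply_symm_apply α

theorem IsContactForm.sharpEta_flatEta (hη : IsContactForm n η)
    (hdim : Module.finrank ℝ E = 2 * n + 1) (x : M) (v : Tan E x) :
    sharpEta η x (flatEta η x v) = v :=
  (hη.flatEta_bijective hdim x).1 (hη.flatEta_sharpEta hdim x _)

theorem IsContactForm.flatEta_reeb (hη : IsContactForm n η)
    (hdim : Module.finrank ℝ E = 2 * n + 1) (x : M) : flatEta η x (reeb η x) = η x :=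
  hη.flatEta_sharpEta hdim x _

/-- A nonzero `v` with `i_v dη = 0` exists in odd dimension. Then `♭(v) = η(v)η = ♭(η(v)ξ)`, so `v =
η(v)ξ`, and `c = η(v)` works. -/
theorem IsContactForm.exists_smul_reeb (hη : IsContactForm n η)
    (hdim : Module.finrank ℝ E = 2 * n + 1) (x : M) :
    ∃ c : ℝ, c ≠ 0 ∧ η x (c • reeb η x) = c ∧ ∀ u, extD η x ![c • reeb η x, u] = 0 := by
  obtain ⟨v, hv, hvu⟩ : ∃ v : Tan E x, v ≠ 0 ∧ ∀ u : Tan E x, extD η x ![v, u] = 0 := by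
    let B : E →ₗ[ℝ] (E →L[ℝ] ℝ) := contract (extD η x)
    exact exists_ne_zero_of_odd_finrank ⟨n, hdim⟩ ((ContinuousLinearMap.coeLM ℝ).comp B)
      (fun u w => alternating_swap (extD η x) u w)
  have hflat : flatEta η x v = flatEta η x (η x v • reeb η x) := by
    rw [map_smul, hη.flatEta_reeb hdim]
    ext u
    rw [flatEta_apply, hvu, neg_zero, zero_add, smul_apply, smul_eq_mul]
  have hveq := (hη.flatEta_bijective hdim x).1 hflat
  refine ⟨η x v, fun h => hv ?_, ?_, ?_⟩
  · rw [hveq, h, zero_smul]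
  · rw [← hveq]
  · rwa [← hveq]

theorem IsContactForm.apply_reeb (hη : IsContactForm n η)
    (hdim : Module.finrank ℝ E = 2 * n + 1) (x : M) : η x (reeb η x) = 1 := by
  obtain ⟨c, hc, h, -⟩ := hη.exists_smul_reeb hdim x
  rw [map_smul, smul_eq_mul] at h
  exact mul_left_cancel₀ hc (by rw [h, mul_one])

theorem IsContactForm.extD_reeb (hη : IsContactForm n η)
    (hdim : Module.finrank ℝ E = 2 * n + 1) (x : M) (u : Tan E x) :
    extD η x ![reeb η x, u] = 0 := by
  obtain ⟨c, hc, -, h⟩ := hη.exists_smul_reeb hdim x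
  have h := h u
  rw [← contract_apply, map_smul, smul_apply, smul_eq_mul, contract_apply] at h
  exact (mul_eq_zero.1 h).resolve_left hc

theorem IsContactForm.flatEta_apply_reeb (hη : IsContactForm n η)
    (hdim : Module.finrank ℝ E = 2 * n + 1) (x : M) (u : Tan E x) :
    flatEta η x u (reeb η x) = η x u := by
  rw [flatEta_apply, alternating_swap, hη.extD_reeb hdim, hη.apply_reeb hdim]
  ring

theorem IsContactForm.contactBiv_flatEta (hη : IsContactForm n η)
    (hdim : Module.finrank ℝ E = 2 * n + 1) (x : M) (u v : Tan E x) :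
    contactBiv η x ![flatEta η x u, flatEta η x v] = extD η x ![u, v] := by
  have h : (fun i => sharpEta η x (![flatEta η x u, flatEta η x v] i)) = ![u, v] := by
    ext i
    fin_cases i
    exacts [hη.sharpEta_flatEta hdim x u, hη.sharpEta_flatEta hdim x v]
  change extD η x (fun i => sharpEta η x (![flatEta η x u, flatEta η x v] i)) = _
  rw [h]

/-- Every covector is some `♭v`, and pairing it with the left side gives `dη(u, v) + η(u)η(v) =
♭(v)(u)`. -/
theorem IsContactForm.anchor_flatEta (hη : IsContactForm n η)
    (hdim : Module.finrank ℝ E = 2 * n + 1) (x : M) (u : Tan E x) :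
    anchor (contactBiv η) (reeb η) x (flatEta η x u) = u := by
  refine eq_of_forall_cot_apply_eq fun β => ?_
  obtain ⟨v, rfl⟩ := (hη.flatEta_bijective hdim x).2 β
  have h : flatEta η x v (anchor (contactBiv η) (reeb η) x (flatEta η x u)) =
      flatEta η x v (sharpBiv (contactBiv η) x (flatEta η x u)) +
        flatEta η x u (reeb η x) * flatEta η x v (reeb η x) := by
    rw [← smul_eq_mul, ← map_smul, ← map_add]
    rfl
  rw [h, apply_sharpBiv, hη.contactBiv_flatEta hdim, hη.flatEta_apply_reeb hdim,
    hη.flatEta_apply_reeb hdim, flatEta_apply, alternating_swap _ u v]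
  ring

theorem IsContactForm.anchor_eq_sharpEta (hη : IsContactForm n η)
    (hdim : Module.finrank ℝ E = 2 * n + 1) (x : M) :
    anchor (contactBiv η) (reeb η) x = sharpEta η x := by
  ext1 α
  obtain ⟨v, rfl⟩ := (hη.flatEta_bijective hdim x).2 α
  rw [hη.anchor_flatEta hdim, hη.sharpEta_flatEta hdim]

theorem IsContactForm.sharpBiv_flatEta (hη : IsContactForm n η)
    (hdim : Module.finrank ℝ E = 2 * n + 1) (x : M) (u : Tan E x) :
    sharpBiv (contactBiv η) x (flatEta η x u) = u - η x u • reeb η x := by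
  rw [eq_sub_iff_add_eq, ← hη.flatEta_apply_reeb hdim]
  exact hη.anchor_flatEta hdim x u

/-- The isomorphism `♭_η` on the fibres over `x`. -/
def IsContactForm.flatEquiv (hη : IsContactForm n η) (hdim : Module.finrank ℝ E = 2 * n + 1)
    (x : M) : Tan E x ≃L[ℝ] Cot E x :=
  LinearEquiv.toContinuousLinearEquiv (𝕜 := ℝ) (E := E) (F := E →L[ℝ] ℝ)
    (LinearEquiv.ofBijective (flatEta η x) (hη.flatEta_bijective hdim x))

theorem IsContactForm.flatEquiv_symm_apply (hη : IsContactForm n η)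
    (hdim : Module.finrank ℝ E = 2 * n + 1) (x : M) (α : Cot E x) :
    (hη.flatEquiv hdim x).symm α = sharpEta η x α := by
  rw [sharpEta, dif_pos (hη.flatEta_bijective hdim x)]
  rfl

variable [T2Space M]

theorem IsContactForm.contMDiffAt_inCoordinates_flatEquiv (hη : IsContactForm n η)
    (hdim : Module.finrank ℝ E = 2 * n + 1) (x : M) :
    ContMDiffAt 𝓘(ℝ, E) 𝓘(ℝ, E →L[ℝ] E →L[ℝ] ℝ) ∞
      (fun y => ContinuousLinearMap.inCoordinates E (fun x : M => TangentSpace 𝓘(ℝ, E) x)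
        (E →L[ℝ] ℝ) (fun x : M => TangentSpace 𝓘(ℝ, E) x →L[ℝ] ℝ) x y x y
        (hη.flatEquiv hdim y : Tan E y →L[ℝ] Cot E y)) x := by
  have : CompleteSpace E := FiniteDimensional.complete ℝ E
  refine contMDiffAt_inCoordinates_of_apply _ (fun X Y hX hY => ?_) x
  exact (contMDiff_extD_apply hη.smooth hX hY).neg.add
    ((hη.smooth.contMDiff_apply hX).mul (hη.smooth.contMDiff_apply hY))

theorem IsContactForm.isBundleMorphism_flatEta (hη : IsContactForm n η)
    (hdim : Module.finrank ℝ E = 2 * n + 1) :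
    IsBundleMorphism E E (E →L[ℝ] ℝ) (V := fun x : M => TangentSpace 𝓘(ℝ, E) x)
      (V' := fun x : M => TangentSpace 𝓘(ℝ, E) x →L[ℝ] ℝ) (flatEta η) :=
  isBundleMorphism_of_inCoordinates (V := fun x : M => TangentSpace 𝓘(ℝ, E) x)
      (V' := fun x : M => TangentSpace 𝓘(ℝ, E) x →L[ℝ] ℝ) (fun x => hη.flatEquiv hdim x)
      (hη.contMDiffAt_inCoordinates_flatEquiv hdim)

theorem IsContactForm.isBundleMorphism_sharpEta (hη : IsContactForm n η)
    (hdim : Module.finrank ℝ E = 2 * n + 1) :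
    IsBundleMorphism E (E →L[ℝ] ℝ) E (V := fun x : M => TangentSpace 𝓘(ℝ, E) x →L[ℝ] ℝ)
      (V' := fun x : M => TangentSpace 𝓘(ℝ, E) x) (sharpEta η) := by
  have : CompleteSpace E := FiniteDimensional.complete ℝ E
  have h := isBundleMorphism_of_inCoordinates (V := fun x : M => TangentSpace 𝓘(ℝ, E) x →L[ℝ] ℝ)
      (V' := fun x : M => TangentSpace 𝓘(ℝ, E) x) (fun x => (hη.flatEquiv hdim x).symm)
      (fun x => contMDiffAt_inCoordinates_symm _ (hη.contMDiffAt_inCoordinates_flatEquiv hdim x))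
  -- `sharpEta` is defined by cases, so it has to be identified with the inverse of `flatEquiv`
  -- fibre by fibre.
  convert h using 2 with x
  ext α
  exact (hη.flatEquiv_symm_apply hdim x α).symm

end ContactForms

/-! ### The bracket of `1`-forms as the transported Lie bracket. -/

section Bracket

variable {E : Type*} [NormedAddCommGroup E] [NormedSpace ℝ E] [FiniteDimensional ℝ E]
  {M : Type*} [TopologicalSpace M] [ChartedSpace E M] [IsManifold 𝓘(ℝ, E) ∞ M]
  {n : ℕ} {η : ∀ x : M, Cot E x} {X Y : ∀ x : M, Tan E x}

theorem dFun_flatEta_apply (hη : IsOneForm η) (hX : IsVectorField X) (hY : IsVectorField Y)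
    (x : M) :
    dFun (E := E) (fun y => flatEta η y (X y) (Y y)) x =
      -dFun (fun y => extD η y ![X y, Y y]) x + η x (X x) • dFun (fun y => η y (Y y)) x +
        η x (Y x) • dFun (fun y => η y (X y)) x := by
  have : CompleteSpace E := FiniteDimensional.complete ℝ E
  have hw := contMDiff_extD_apply hη hX hY
  have h1 := hη.contMDiff_apply hX
  have h2 := hη.contMDiff_apply hY
  have h12 : ContMDiff 𝓘(ℝ, E) 𝓘(ℝ, ℝ) ∞ (fun y => η y (X y) * η y (Y y)) := h1.mul h2
  simp only [flatEta_apply]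
  rw [dFun_add hw.neg h12, dFun_neg, dFun_mul h1 h2, add_assoc]

/-- Pointwise algebra, with no smoothness of `X`, `Y`: since `♯_π(♭X) = X - η(X)ξ`, the contractions
with `ξ` in the Koszul part cancel those in `η(X) L_ξ(♭Y)` and `η(Y) L_ξ(♭X)`. Of `d(dη(X, Y))`, two
copies come from the Lie derivatives and one is subtracted. -/
theorem IsContactForm.bracket_flatEta_eq (hη : IsContactForm n η)
    (hdim : Module.finrank ℝ E = 2 * n + 1) (X Y : ∀ x : M, Tan E x) (x : M) :
    bracket (contactBiv η) (reeb η) η (fun y => flatEta η y (X y)) (fun y => flatEta η y (Y y)) x =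
      contract (extD (fun y => flatEta η y (Y y)) x) (X x) -
        contract (extD (fun y => flatEta η y (X y)) x) (Y x) +
        dFun (fun y => extD η y ![X y, Y y]) x +
        η x (X x) • (dFun (fun y => η y (Y y)) x - flatEta η x (Y x)) -
        η x (Y x) • (dFun (fun y => η y (X y)) x - flatEta η x (X x)) -
        extD η x ![X x, Y x] • η x := by
  simp only [bracket, koszulBracket, lieDer, apply_sharpBiv, hη.contactBiv_flatEta hdim,
    hη.flatEta_apply_reeb hdim, dFun_extD_swap η X Y]
  simp only [hη.sharpBiv_flatEta hdim, map_sub, map_smul]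
  module

variable [T2Space M]

theorem IsContactForm.isOneForm_flatEta (hη : IsContactForm n η)
    (hdim : Module.finrank ℝ E = 2 * n + 1) (hX : IsVectorField X) :
    IsOneForm (fun x => flatEta η x (X x)) :=
  (hη.isBundleMorphism_flatEta hdim).smoothSection hX

theorem IsContactForm.isVectorField_sharpEta (hη : IsContactForm n η)
    (hdim : Module.finrank ℝ E = 2 * n + 1) {α : ∀ x : M, Cot E x} (hα : IsOneForm α) :
    IsVectorField (fun x => sharpEta η x (α x)) :=
  (hη.isBundleMorphism_sharpEta hdim).smoothSection
    (V := fun x : M => TangentSpace 𝓘(ℝ, E) x →L[ℝ] ℝ)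
    (V' := fun x : M => TangentSpace 𝓘(ℝ, E) x) hα

/-- The bracket of `♭_η(X)` and `♭_η(Y)` is `♭_η([X, Y])`. -/
theorem IsContactForm.bracket_flatEta (hη : IsContactForm n η)
    (hdim : Module.finrank ℝ E = 2 * n + 1) (hX : IsVectorField X) (hY : IsVectorField Y)
    (x : M) :
    bracket (contactBiv η) (reeb η) η (fun y => flatEta η y (X y)) (fun y => flatEta η y (Y y)) x =
      flatEta η x (VectorField.mlieBracket 𝓘(ℝ, E) X Y x) := by
  have : CompleteSpace E := FiniteDimensional.complete ℝ E
  rw [hη.bracket_flatEta_eq hdim]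
  ext v
  -- Both sides are covectors at `x`, so the test vector may be extended to a smooth field, to which
  -- the formulas for `d` apply.
  obtain ⟨Z, hZ, rfl⟩ := exists_isVectorField_apply_eq x v
  have hcl := extD_closed hη.smooth hX hY hZ x
  have hXY := extD_apply hη.smooth hX hY x
  have hXZ := extD_apply hη.smooth hX hZ x
  have hYZ := extD_apply hη.smooth hY hZ x
  have hα := extD_apply (hη.isOneForm_flatEta hdim hX) hY hZ x
  have hβ := extD_apply (hη.isOneForm_flatEta hdim hY) hX hZ x
  rw [dFun_flatEta_apply hη.smooth hX hZ, dFun_flatEta_apply hη.smooth hX hY] at hα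
  rw [dFun_flatEta_apply hη.smooth hY hZ, dFun_flatEta_apply hη.smooth hY hX,
    dFun_extD_swap η X Y] at hβ
  rw [alternating_swap _ (Y x), alternating_swap _ (X x)] at hcl
  simp only [add_apply, sub_apply, smul_apply, neg_apply, contract_apply, flatEta_apply,
    smul_eq_mul] at hα hβ ⊢
  -- `hβ` and `hα` expand `d(♭Y)` and `d(♭X)`, `hcl` removes the `dη` terms, and the last three
  -- expand `dη` in the products with `η`.
  linear_combination hβ - hα - hcl - η x (Z x) * hXY - η x (Y x) * hXZ + η x (X x) * hYZ

/-- The bracket of two `1`-forms is the image under `♭_η` of the bracket of vector fields. -/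
theorem IsContactForm.bracket_eq (hη : IsContactForm n η)
    (hdim : Module.finrank ℝ E = 2 * n + 1) {α β : ∀ x : M, Cot E x} (hα : IsOneForm α)
    (hβ : IsOneForm β) :
    bracket (contactBiv η) (reeb η) η α β =
      fun x => flatEta η x (VectorField.mlieBracket 𝓘(ℝ, E) (fun y => sharpEta η y (α y))
        (fun y => sharpEta η y (β y)) x) := by
  ext1 x
  rw [← hη.bracket_flatEta hdim (hη.isVectorField_sharpEta hdim hα)
    (hη.isVectorField_sharpEta hdim hβ)]
  simp only [hη.flatEta_sharpEta hdim]

end Bracket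

end ContactAlgebroid

end

/-! ### Transport of the algebroid structure from `TM`. -/

open ContactAlgebroid in
theorem mainTheorem5 {E : Type*} [NormedAddCommGroup E] [NormedSpace ℝ E] [FiniteDimensional ℝ E]
    {M : Type*} [TopologicalSpace M] [T2Space M] [ChartedSpace E M] [IsManifold 𝓘(ℝ, E) ∞ M]
    (n : ℕ) (hn : 1 ≤ n) (hdim : Module.finrank ℝ E = 2 * n + 1)
    (η : ∀ x : M, TangentSpace 𝓘(ℝ, E) x →L[ℝ] ℝ) (hη : IsContactForm n η) :
    (∀ x, Function.Bijective (flatEta η x)) ∧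
    (∀ x, anchor (contactBiv η) (reeb η) x = sharpEta η x) ∧
    IsLieAlgebroid (E →L[ℝ] ℝ) (V := fun x : M => TangentSpace 𝓘(ℝ, E) x →L[ℝ] ℝ)
      (anchor (contactBiv η) (reeb η)) (bracket (contactBiv η) (reeb η) η) ∧
    ∃ Φ : ∀ x : M, (TangentSpace 𝓘(ℝ, E) x →L[ℝ] ℝ) ≃ₗ[ℝ] TangentSpace 𝓘(ℝ, E) x,
      IsAlgebroidIso (E →L[ℝ] ℝ) E (V := fun x : M => TangentSpace 𝓘(ℝ, E) x →L[ℝ] ℝ)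
        (anchor (contactBiv η) (reeb η)) (bracket (contactBiv η) (reeb η) η)
        (fun _ => LinearMap.id) (VectorField.mlieBracket 𝓘(ℝ, E)) Φ := by
  have : CompleteSpace E := FiniteDimensional.complete ℝ E
  have hs : ∀ {α : ∀ x : M, Cot E x}, IsOneForm α → IsVectorField (fun x => sharpEta η x (α x)) :=
    fun hα => hη.isVectorField_sharpEta hdim hα
  have hd : ∀ {X : ∀ x : M, Tan E x}, IsVectorField X → ∀ x, MDifferentiableAt 𝓘(ℝ, E)
      (𝓘(ℝ, E).prod 𝓘(ℝ, E)) (fun x => (X x : TangentBundle 𝓘(ℝ, E) M)) x :=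
    fun hX x => (hX x).mdifferentiableAt (by simp)
  have : IsManifold 𝓘(ℝ, E) 2 M := IsManifold.of_le (n := ∞) (by norm_cast)
  have hbr : ∀ {α β : ∀ x : M, Cot E x}, IsOneForm α → IsOneForm β →
      IsOneForm (bracket (contactBiv η) (reeb η) η α β) := fun hα hβ => by
    rw [hη.bracket_eq hdim hα hβ]
    exact hη.isOneForm_flatEta hdim ((hs hα).mlieBracket (hs hβ))
  have hadd : ∀ {α β : ∀ x : M, Cot E x}, IsOneForm α → IsOneForm β →
      IsOneForm (fun x => α x + β x) := fun hα hβ =>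
    ContMDiff.add_section (V := fun x : M => TangentSpace 𝓘(ℝ, E) x →L[ℝ] ℝ) hα hβ
  have hsmul : ∀ {φ : M → ℝ} {α : ∀ x : M, Cot E x}, ContMDiff 𝓘(ℝ, E) 𝓘(ℝ, ℝ) ∞ φ →
      IsOneForm α → IsOneForm (fun x => φ x • α x) := fun hφ hα =>
    ContMDiff.smul_section (V := fun x : M => TangentSpace 𝓘(ℝ, E) x →L[ℝ] ℝ) hφ hα
  have hanchor : anchor (contactBiv η) (reeb η) = sharpEta η :=
    funext fun x => hη.anchor_eq_sharpEta hdim x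
  refine ⟨hη.flatEta_bijective hdim, hη.anchor_eq_sharpEta hdim, ?_, ?_⟩
  · rw [hanchor]
    refine ⟨⟨hη.isBundleMorphism_sharpEta hdim, fun _ _ => hbr, ?_, ?_, ?_, ?_, ?_, ?_⟩, ?_⟩
    · intro s s' t h h' ht
      rw [hη.bracket_eq hdim (hadd h h') ht, hη.bracket_eq hdim h ht, hη.bracket_eq hdim h' ht]
      ext1 x
      rw [← map_add, ← VectorField.mlieBracket_add_left (hd (hs h) x) (hd (hs h') x)]
      simp only [map_add]
      rfl
    · intro c s t h ht
      rw [hη.bracket_eq hdim (hsmul contMDiff_const h) ht, hη.bracket_eq hdim h ht]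
      ext1 x
      rw [← map_smul, ← VectorField.mlieBracket_const_smul_left (hd (hs h) x)]
      simp only [map_smul]
      rfl
    · intro s t t' h ht ht'
      rw [hη.bracket_eq hdim h (hadd ht ht'), hη.bracket_eq hdim h ht, hη.bracket_eq hdim h ht']
      ext1 x
      rw [← map_add, ← VectorField.mlieBracket_add_right (hd (hs ht) x) (hd (hs ht') x)]
      simp only [map_add]
      rfl
    · intro c s t h ht
      rw [hη.bracket_eq hdim h (hsmul contMDiff_const ht), hη.bracket_eq hdim h ht]
      ext1 x
      rw [← map_smul, ← VectorField.mlieBracket_const_smul_right (hd (hs ht) x)]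
      simp only [map_smul]
      rfl
    · intro s h
      rw [hη.bracket_eq hdim h h]
      ext1 x
      rw [VectorField.mlieBracket_self]
      exact map_zero _
    · intro φ s t hφ h ht
      rw [hη.bracket_eq hdim h (hsmul hφ ht), hη.bracket_eq hdim h ht]
      ext1 x
      have hl := VectorField.mlieBracket_smul_right (V := fun x => sharpEta η x (s x))
        ((hφ x).mdifferentiableAt (by simp)) (hd (hs ht) x)
      have hsm : (fun x => sharpEta η x (φ x • t x)) = φ • fun x => sharpEta η x (t x) := by
        ext1 x
        exact map_smul _ _ _
      -- Applying `♭` to `[♯s, φ ♯t] = ♯s(φ) ♯t + φ [♯s, ♯t]` turns `♯t` back into `t`.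
      rw [hsm, hl, map_add, map_smul, map_smul, hη.flatEta_sharpEta hdim, add_comm]
      rfl
    · intro s t r h ht hr
      rw [hη.bracket_eq hdim h (hbr ht hr), hη.bracket_eq hdim ht (hbr hr h),
        hη.bracket_eq hdim hr (hbr h ht), hη.bracket_eq hdim ht hr, hη.bracket_eq hdim hr h,
        hη.bracket_eq hdim h ht]
      ext1 x
      -- The inner brackets are images under `♭`, which the outer `♯` undoes, leaving `♭` of the
      -- cyclic sum for vector fields.
      simp only [hη.sharpEta_flatEta hdim]
      rw [← map_add, ← map_add, mlieBracket_cyclic (hs h) (hs ht) (hs hr)]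
      exact map_zero _
  · refine ⟨fun x => (hη.flatEquiv hdim x).symm.toLinearEquiv, ?_, ?_, ?_, ?_⟩
    · convert hη.isBundleMorphism_sharpEta hdim using 2 with x
      ext α
      exact hη.flatEquiv_symm_apply hdim x α
    · exact hη.isBundleMorphism_flatEta hdim
    · intro x α
      rw [hη.anchor_eq_sharpEta hdim]
      exact hη.flatEquiv_symm_apply hdim x α
    · intro s t h ht
      have hΦ : ∀ x (α : Cot E x), (hη.flatEquiv hdim x).symm.toLinearEquiv α = sharpEta η x α :=
        hη.flatEquiv_symm_apply hdim
      simp only [hΦ]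
      rw [hη.bracket_eq hdim h ht]
      simp only [hη.sharpEta_flatEta hdim]
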